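/- Let $\mathbb{K}$ be the digital line, that is, $\mathbb{Z}$ with the (Khalimsky) topology generated by the sets $N(n)=\{n\}$ for $n$ odd and $N(n)=\{n-1,n,n+1\}$ for $n$ even, and let $\mathbb{K}^2$ carry the product topology. A point $(x,y)\in\mathbb{K}^2$ is pure if $x$ and $y$ are both even or both odd. Two distinct points $p,q$ are adjacent if $\{p,q\}$ is connected, and a point is adjacent to a set if it is adjacent to some point of that set. An arc is a subset that, with the subspace topology, is homeomorphic to a nonempty finite interval $\{a,a+1,\dots,b\}$ of $\mathbb{K}$. A Jordan curve is a connected set $J$ with $|J|\ge 4$ such that $J\setminus\{p\}$ is an arc for every $p\in J$. Theorem. If $J\subseteq\mathbb{K}^2$ is a Jordan curve with $|J|>4$, all of whose points are pure, then $\mathbb{K}^2\setminus J$ has exactly two connected components. Moreover, every point of $J$ is adjacent to both components of $\mathbb{K}^2\setminus J$. -/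

import Mathlib

/-- The underlying set `ℤ` of the digital line (a type synonym, so that it does not inherit
the discrete topology of `ℤ`). -/
def DigitalLine : Type := ℤ

namespace DigitalLine

/-- The identity map, viewing an integer as a point of the digital line. -/
def ofInt : ℤ ≃ DigitalLine := Equiv.refl ℤ

/-- The identity map, viewing a point of the digital line as an integer. -/
def toInt : DigitalLine ≃ ℤ := ofInt.symm

/-- The generating set `N(n)`: it is `{n}` if `n` is odd and `{n - 1, n, n + 1}` if `n` is even. -/
def basicNhd (n : ℤ) : Set DigitalLine :=
  {m | (Odd n ∧ toInt m = n) ∨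
    (Even n ∧ (toInt m = n - 1 ∨ toInt m = n ∨ toInt m = n + 1))}

/-- The Khalimsky topology, generated by the sets `N(n)`. -/
instance : TopologicalSpace DigitalLine :=
  TopologicalSpace.generateFrom (Set.range basicNhd)

/-- The finite interval `{a, a + 1, …, b}` of the digital line. -/
def interval (a b : ℤ) : Set DigitalLine :=
  {m | a ≤ toInt m ∧ toInt m ≤ b}

end DigitalLine

/-- The digital plane, with the product topology. -/
abbrev DigitalPlane : Type := DigitalLine × DigitalLine

namespace DigitalTopology

/-- A point of the digital plane is pure if its coordinates are both even or both odd. -/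
def IsPure (p : DigitalPlane) : Prop :=
  (Even (DigitalLine.toInt p.1) ∧ Even (DigitalLine.toInt p.2)) ∨
    (Odd (DigitalLine.toInt p.1) ∧ Odd (DigitalLine.toInt p.2))

/-- The adjacency `A(x)` of a point: all `y ≠ x` such that `{x, y}` is connected. -/
def adjacency {X : Type*} [TopologicalSpace X] (x : X) : Set X :=
  {y | y ≠ x ∧ IsConnected ({x, y} : Set X)}

/-- A point is adjacent to a set if it is adjacent to some point of the set. -/
def AdjacentToSet {X : Type*} [TopologicalSpace X] (x : X) (S : Set X) : Prop :=
  ∃ y ∈ S, y ∈ adjacency x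

/-- An arc: a subset that, with the subspace topology, is homeomorphic to a (nonempty) finite
interval of the digital line. -/
def IsArc {X : Type*} [TopologicalSpace X] (C : Set X) : Prop :=
  ∃ a b : ℤ, a ≤ b ∧ Nonempty (DigitalLine.interval a b ≃ₜ C)

/-- A Jordan curve: a connected set `J` with at least four points such that removing any
point of `J` leaves an arc. -/
structure IsJordanCurve {X : Type*} [TopologicalSpace X] (J : Set X) : Prop where
  isConnected : IsConnected J
  four_le_encard : 4 ≤ J.encard
  isArc_diff : ∀ x ∈ J, IsArc (J \ {x})

/-- The set of connected components of the subspace `S`. -/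
def components {X : Type*} [TopologicalSpace X] (S : Set X) : Set (Set X) :=
  {C | ∃ x ∈ S, C = connectedComponentIn S x}

end DigitalTopology

/-!
The pure points form a copy of the lattice `ℤ²`, rotated by 45 degrees, whose unit squares have the
mixed points as their centres. Removing a point of `J` other than `p` and its neighbours leaves an
arc, so every `p` in `J` has exactly two neighbours in `J`. Hence `J` cuts the cycle of the eight
neighbours of `p` in two pieces, which contain the two mixed points beside an edge of `J` at `p`.
Both ends of the edge touch the components of these two points and no others; since `J` is
connected, all its points touch the same components, at most two in number, and the connectedness
of the plane shows that there are no other components.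

That the two sides of an edge lie in different components is a parity argument. Counting the
crossings of `J` modulo 2 defines a `1`-form on the squares of the lattice. It is closed because
every point of `J` has even degree, hence exact, and its potential is a 2-colouring which is
constant on each component of the complement and changes across every edge of `J`.
-/

namespace DigitalTopology

section General

variable {X Y : Type*} [TopologicalSpace X] [TopologicalSpace Y]

theorem mem_adjacency_comm {x y : X} : y ∈ adjacency x ↔ x ∈ adjacency y := by
  simp only [adjacency, Set.mem_ofPred_eq, Set.pair_comm x y, ne_comm]

theorem isConnected_pair_of_specializes {x y : X} (h : x ⤳ y) :
    IsConnected ({x, y} : Set X) :=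
  isConnected_singleton.subset_closure (Set.singleton_subset_iff.2 (Set.mem_insert x {y}))
    (Set.pair_subset_iff.2 ⟨subset_closure rfl, h.mem_closure⟩)

/-- In an Alexandrov-discrete space every `x` has a smallest neighbourhood, the set of all `y ⤳ x`,
so adjacency is comparability in the specialization order. -/
theorem mem_adjacency_iff_specializes [AlexandrovDiscrete X] {x y : X} :
    y ∈ adjacency x ↔ y ≠ x ∧ (x ⤳ y ∨ y ⤳ x) := by
  refine and_congr_right fun hne => ⟨fun h => ?_, ?_⟩
  · by_contra! hxy
    obtain ⟨z, hz, hzx, hzy⟩ := h.isPreconnected (nhdsKer {x}) (nhdsKer {y})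
      isOpen_nhdsKer isOpen_nhdsKer
      (Set.pair_subset_iff.2 ⟨.inl (subset_nhdsKer rfl), .inr (subset_nhdsKer rfl)⟩)
      ⟨x, by simp, subset_nhdsKer rfl⟩ ⟨y, by simp, subset_nhdsKer rfl⟩
    rw [mem_nhdsKer_singleton] at hzx hzy
    obtain rfl | rfl := hz
    exacts [hxy.1 hzy, hxy.2 hzx]
  · rintro (h | h)
    · exact isConnected_pair_of_specializes h
    · exact Set.pair_comm x y ▸ isConnected_pair_of_specializes h

theorem eq_of_isPreconnected_of_mem_adjacency [AlexandrovDiscrete X] {α : Type*} {S : Set X}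
    (hS : IsPreconnected S) {f : X → α}
    (hf : ∀ x ∈ S, ∀ y ∈ S, y ∈ adjacency x → f x = f y) {x y : X} (hx : x ∈ S) (hy : y ∈ S) :
    f x = f y := by
  refine hS.induction₂ (fun x y => f x = f y) (fun x hx => ?_)
    (fun _ _ _ _ _ _ => Eq.trans) (fun _ _ _ _ => Eq.symm) hx hy
  filter_upwards [self_mem_nhdsWithin,
    nhdsWithin_le_nhds (isOpen_nhdsKer.mem_nhds (subset_nhdsKer (Set.mem_singleton x)))]
    with y hy hyx
  rw [mem_nhdsKer_singleton] at hyx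
  obtain rfl | hne := eq_or_ne y x
  · rfl
  · exact hf x hx y hy (mem_adjacency_iff_specializes.2 ⟨hne, .inr hyx⟩)

theorem mem_adjacency_subtype {S : Set X} {x y : S} :
    y ∈ adjacency x ↔ (y : X) ∈ adjacency (x : X) := by
  have hpair : ((↑) : S → X) '' {x, y} = {(x : X), (y : X)} := Set.image_pair _ x y
  simp only [adjacency, Set.mem_ofPred_eq, IsConnected, Set.insert_nonempty, true_and, ← hpair,
    Topology.IsInducing.subtypeVal.isPreconnected_image, Ne, Subtype.ext_iff]

theorem homeomorph_mem_adjacency_iff (e : X ≃ₜ Y) {x y : X} :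
    e y ∈ adjacency (e x) ↔ y ∈ adjacency x := by
  simp only [adjacency, Set.mem_ofPred_eq, ← Set.image_pair, e.isConnected_image, Ne,
    e.injective.eq_iff]

theorem connectedComponentIn_eq_of_mem_adjacency {S : Set X} {x y : X} (hx : x ∈ S) (hy : y ∈ S)
    (h : y ∈ adjacency x) : connectedComponentIn S x = connectedComponentIn S y :=
  connectedComponentIn_eq <| h.2.isPreconnected.subset_connectedComponentIn (by simp)
    (Set.pair_subset_iff.2 ⟨hx, hy⟩) (by simp)

theorem eq_connectedComponentIn_of_mem_components {S C : Set X} (hC : C ∈ components S) {y : X}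
    (hy : y ∈ C) : C = connectedComponentIn S y := by
  obtain ⟨x, -, rfl⟩ := hC
  exact connectedComponentIn_eq hy

theorem subset_of_mem_components {S C : Set X} (hC : C ∈ components S) : C ⊆ S := by
  obtain ⟨x, -, rfl⟩ := hC
  exact connectedComponentIn_subset S x

theorem nonempty_of_mem_components {S C : Set X} (hC : C ∈ components S) : C.Nonempty := by
  obtain ⟨x, hx, rfl⟩ := hC
  exact connectedComponentIn_nonempty_iff.2 hx

theorem exists_mem_adjacentToSet [AlexandrovDiscrete X] [PreconnectedSpace X] {J C : Set X}
    (hJ : J.Nonempty) (hC : C ∈ components Jᶜ) : ∃ p ∈ J, AdjacentToSet p C := by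
  by_contra! hno
  have mem_of_adj : ∀ x ∈ C, ∀ y ∈ adjacency x, y ∈ C := by
    intro x hx y hxy
    have hy : y ∉ J := fun hy => hno y hy ⟨x, hx, mem_adjacency_comm.1 hxy⟩
    rw [eq_connectedComponentIn_of_mem_components hC hx,
      connectedComponentIn_eq_of_mem_adjacency (subset_of_mem_components hC hx) hy hxy]
    exact mem_connectedComponentIn hy
  obtain ⟨p, hp⟩ := hJ
  obtain ⟨x, hx⟩ := nonempty_of_mem_components hC
  have hxp : (x ∈ C) = (p ∈ C) :=
    eq_of_isPreconnected_of_mem_adjacency (f := (· ∈ C)) isPreconnected_univ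
      (fun u _ v _ huv => propext ⟨fun hu => mem_of_adj u hu v huv,
        fun hv => mem_of_adj v hv u (mem_adjacency_comm.1 huv)⟩)
      (Set.mem_univ x) (Set.mem_univ p)
  exact subset_of_mem_components hC (hxp.mp hx) hp

end General

section Potential

variable {G : Type*} [AddCommGroup G]

theorem exists_forall_add_one_eq_add (e : ℤ → G) : ∃ f : ℤ → G, ∀ n, f (n + 1) = f n + e n := by
  let f (n : ℤ) : G :=
    Int.inductionOn' n 0 0 (fun k _ x => x + e k) (fun k _ x => x - e (k - 1))
  refine ⟨f, fun n => ?_⟩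
  obtain hn | hn := le_or_gt 0 n
  · exact Int.inductionOn'_add_one hn
  · have : f (n + 1 - 1) = f (n + 1) - e (n + 1 - 1) := Int.inductionOn'_sub_one (by omega)
    rw [add_sub_cancel_right] at this
    rw [this, sub_add_cancel]

/-- The discrete Poincaré lemma for the `1`-form `(e₁, e₂)`; `hclosed` says that its integral around
each unit square vanishes. -/
theorem exists_potential {e₁ e₂ : ℤ → ℤ → G}
    (hclosed : ∀ i j, e₁ i j + e₂ (i + 1) j = e₂ i j + e₁ i (j + 1)) :
    ∃ f : ℤ → ℤ → G, ∀ i j, f (i + 1) j = f i j + e₁ i j ∧ f i (j + 1) = f i j + e₂ i j := by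
  choose v hv using fun i => exists_forall_add_one_eq_add (e₂ i)
  let d (i j : ℤ) : G := e₁ i j - (v (i + 1) j - v i j)
  have hd : ∀ i j, d i (j + 1) = d i j := by
    intro i j
    simp only [d, hv, eq_sub_of_add_eq' (hclosed i j).symm]
    abel
  have hd_zero : ∀ i j, d i j = d i 0 := fun i j => by
    simpa using Function.Periodic.int_mul_eq (hd i) j
  obtain ⟨w, hw⟩ := exists_forall_add_one_eq_add fun i => d i 0
  refine ⟨fun i j => v i j + w i, fun i j => ⟨?_, ?_⟩⟩
  · simp only [hw, ← hd_zero i j, d]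
    abel
  · simp only [hv, add_right_comm]

end Potential

end DigitalTopology

namespace DigitalLine

open DigitalTopology

theorem ofInt_mem_basicNhd {m n : ℤ} :
    ofInt m ∈ basicNhd n ↔ m = n ∨ Even n ∧ (m = n - 1 ∨ m = n + 1) := by
  change (Odd n ∧ m = n) ∨ (Even n ∧ (m = n - 1 ∨ m = n ∨ m = n + 1)) ↔ _
  rw [← Int.not_even_iff_odd]
  tauto

theorem isOpen_basicNhd (n : ℤ) : IsOpen (basicNhd n) :=
  TopologicalSpace.isOpen_generateFrom_of_mem ⟨n, rfl⟩

theorem nhds_ofInt (n : ℤ) : nhds (ofInt n) = Filter.principal (basicNhd n) := by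
  refine le_antisymm
    (Filter.le_principal_iff.2 ((isOpen_basicNhd n).mem_nhds (ofInt_mem_basicNhd.2 (.inl rfl)))) ?_
  rw [TopologicalSpace.nhds_generateFrom]
  simp only [le_iInf_iff, Filter.principal_mono]
  rintro _ ⟨hn, k, rfl⟩ m hm
  obtain ⟨m, rfl⟩ := ofInt.surjective m
  rw [ofInt_mem_basicNhd] at hn hm ⊢
  grind

theorem ofInt_specializes_iff {m n : ℤ} :
    ofInt m ⤳ ofInt n ↔ m = n ∨ Even n ∧ (m = n - 1 ∨ m = n + 1) := by
  rw [specializes_iff_pure, nhds_ofInt, Filter.pure_le_principal, ofInt_mem_basicNhd]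

instance : AlexandrovDiscrete DigitalLine :=
  alexandrovDiscrete_iff_nhds.2 <| ofInt.surjective.forall.2 fun n => by
    rw [nhdsKer_singleton_eq_ker_nhds, nhds_ofInt, Filter.ker_principal]

theorem ofInt_mem_adjacency_iff {m n : ℤ} :
    ofInt m ∈ adjacency (ofInt n) ↔ m = n - 1 ∨ m = n + 1 := by
  rw [mem_adjacency_iff_specializes, ofInt_specializes_iff, ofInt_specializes_iff, Ne,
    ofInt.apply_eq_iff_eq]
  grind

instance : PreconnectedSpace DigitalLine := by
  have hunion : ⋃ n : ℤ, {ofInt n, ofInt (n + 1)} = Set.univ :=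
    Set.eq_univ_of_forall fun m => Set.mem_iUnion.2 ⟨toInt m, .inl rfl⟩
  refine ⟨hunion ▸ IsPreconnected.iUnion_of_chain (fun n => ?_) fun n => ?_⟩
  · exact (ofInt_mem_adjacency_iff.2 (.inr rfl)).2.isPreconnected
  · exact ⟨ofInt (n + 1), .inr rfl, .inl rfl⟩

end DigitalLine

namespace DigitalTopology

open DigitalLine

section Arc

variable {X : Type*} [TopologicalSpace X] {C J : Set X} {p q r s : X}

theorem IsArc.exists_coordinate (hC : IsArc C) :
    ∃ (a b : ℤ) (f : C → ℤ), f.Injective ∧ Set.range f = Set.Icc a b ∧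
      ∀ x y : C, (y : X) ∈ adjacency (x : X) ↔ f y = f x - 1 ∨ f y = f x + 1 := by
  obtain ⟨a, b, -, ⟨e⟩⟩ := hC
  refine ⟨a, b, fun x => toInt (e.symm x),
    toInt.injective.comp (Subtype.val_injective.comp e.symm.injective), ?_, fun x y => ?_⟩
  · ext n
    constructor
    · rintro ⟨x, rfl⟩
      exact (e.symm x).2
    · intro hn
      exact ⟨e ⟨ofInt n, hn⟩, by simp [toInt]⟩
  · rw [← mem_adjacency_subtype, ← homeomorph_mem_adjacency_iff e.symm, mem_adjacency_subtype]
    exact ofInt_mem_adjacency_iff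

theorem IsArc.exists_mem_adjacency (hC : IsArc C) (hnt : C.Nontrivial) (hp : p ∈ C) :
    ∃ q ∈ C, q ∈ adjacency p := by
  obtain ⟨a, b, f, hinj, hrange, hadj⟩ := hC.exists_coordinate
  obtain ⟨x, hx, hxp⟩ := hnt.exists_ne p
  have hne : f ⟨x, hx⟩ ≠ f ⟨p, hp⟩ := hinj.ne (Subtype.coe_ne_coe.1 hxp)
  have hfx : f ⟨x, hx⟩ ∈ Set.Icc a b := hrange ▸ Set.mem_range_self _
  have hfp : f ⟨p, hp⟩ ∈ Set.Icc a b := hrange ▸ Set.mem_range_self _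
  obtain ⟨n, hn, hnp⟩ : ∃ n ∈ Set.Icc a b, n = f ⟨p, hp⟩ - 1 ∨ n = f ⟨p, hp⟩ + 1 := by
    rw [Set.mem_Icc] at hfx hfp
    rcases hne.lt_or_gt with hlt | hlt
    · exact ⟨_, ⟨by omega, by omega⟩, .inl rfl⟩
    · exact ⟨_, ⟨by omega, by omega⟩, .inr rfl⟩
  obtain ⟨q, rfl⟩ : n ∈ Set.range f := hrange ▸ hn
  exact ⟨q, q.2, (hadj ⟨p, hp⟩ q).2 hnp⟩

theorem IsArc.eq_or_eq_or_eq_of_mem_adjacency (hC : IsArc C) (hp : p ∈ C)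
    (hq : q ∈ adjacency p ∩ C) (hr : r ∈ adjacency p ∩ C) (hs : s ∈ adjacency p ∩ C) :
    q = r ∨ q = s ∨ r = s := by
  obtain ⟨a, b, f, hinj, -, hadj⟩ := hC.exists_coordinate
  have hfq := (hadj ⟨p, hp⟩ ⟨q, hq.2⟩).1 hq.1
  have hfr := (hadj ⟨p, hp⟩ ⟨r, hr.2⟩).1 hr.1
  have hfs := (hadj ⟨p, hp⟩ ⟨s, hs.2⟩).1 hs.1
  have hf : f ⟨q, hq.2⟩ = f ⟨r, hr.2⟩ ∨ f ⟨q, hq.2⟩ = f ⟨s, hs.2⟩ ∨ f ⟨r, hr.2⟩ = f ⟨s, hs.2⟩ := by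
    omega
  simpa only [hinj.eq_iff, Subtype.mk.injEq] using hf

theorem IsArc.notMem_adjacency_of_mem_adjacency (hC : IsArc C) (hp : p ∈ C)
    (hq : q ∈ adjacency p ∩ C) (hr : r ∈ adjacency p ∩ C) : r ∉ adjacency q := by
  obtain ⟨a, b, f, -, -, hadj⟩ := hC.exists_coordinate
  have hfq := (hadj ⟨p, hp⟩ ⟨q, hq.2⟩).1 hq.1
  have hfr := (hadj ⟨p, hp⟩ ⟨r, hr.2⟩).1 hr.1
  rw [hadj ⟨q, hq.2⟩ ⟨r, hr.2⟩]
  omega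

namespace IsJordanCurve

theorem nontrivial_diff_singleton (hJ : IsJordanCurve J) (hp : p ∈ J) :
    (J \ {p}).Nontrivial := by
  rw [← Set.one_lt_encard_iff_nontrivial]
  have hcard := hJ.four_le_encard
  rw [← Set.encard_sdiff_singleton_add_one hp] at hcard
  by_contra! hle
  exact absurd (hcard.trans (add_le_add_left hle 1)) (by norm_num)

theorem nontrivial_adjacency_inter (hJ : IsJordanCurve J) (hp : p ∈ J) :
    (adjacency p ∩ J).Nontrivial := by
  have exists_adj : ∀ x ∈ J, x ≠ p → ∃ q ∈ J \ {x}, q ∈ adjacency p := fun x hx hxp =>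
    (hJ.isArc_diff x hx).exists_mem_adjacency (hJ.nontrivial_diff_singleton hx) ⟨hp, hxp.symm⟩
  obtain ⟨x, ⟨hx, hxp⟩, -⟩ := (hJ.nontrivial_diff_singleton hp).exists_ne p
  obtain ⟨q, ⟨hq, -⟩, hqp⟩ := exists_adj x hx hxp
  obtain ⟨r, ⟨hr, hrq⟩, hrp⟩ := exists_adj q hq hqp.1
  exact ⟨q, ⟨hqp, hq⟩, r, ⟨hrp, hr⟩, Ne.symm hrq⟩

/-- If `p` had three neighbours `q`, `r`, `s`, then removing a fifth point of `J` would leave an arc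
in which `p` still has three neighbours. Hence `J = {p, q, r, s}`, and `q` has no neighbour in the
arc `J \ {p}`. -/
theorem eq_or_eq_or_eq_of_mem_adjacency (hJ : IsJordanCurve J) (hp : p ∈ J)
    (hq : q ∈ adjacency p ∩ J) (hr : r ∈ adjacency p ∩ J) (hs : s ∈ adjacency p ∩ J) :
    q = r ∨ q = s ∨ r = s := by
  by_contra! hne
  have mem_of_mem : ∀ x ∈ J, x = p ∨ x = q ∨ x = r ∨ x = s := by
    intro x hx
    by_contra! hxne
    have := (hJ.isArc_diff x hx).eq_or_eq_or_eq_of_mem_adjacency ⟨hp, hxne.1.symm⟩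
      ⟨hq.1, hq.2, hxne.2.1.symm⟩ ⟨hr.1, hr.2, hxne.2.2.1.symm⟩ ⟨hs.1, hs.2, hxne.2.2.2.symm⟩
    tauto
  have not_adj_r : r ∉ adjacency q :=
    (hJ.isArc_diff s hs.2).notMem_adjacency_of_mem_adjacency ⟨hp, hs.1.1.symm⟩
      ⟨hq.1, hq.2, hne.2.1⟩ ⟨hr.1, hr.2, hne.2.2⟩
  have not_adj_s : s ∉ adjacency q :=
    (hJ.isArc_diff r hr.2).notMem_adjacency_of_mem_adjacency ⟨hp, hr.1.1.symm⟩
      ⟨hq.1, hq.2, hne.1⟩ ⟨hs.1, hs.2, hne.2.2.symm⟩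
  obtain ⟨x, ⟨hx, hxp⟩, hxq⟩ := (hJ.isArc_diff p hp).exists_mem_adjacency
    (hJ.nontrivial_diff_singleton hp) ⟨hq.2, hq.1.1⟩
  obtain rfl | rfl | rfl | rfl := mem_of_mem x hx
  exacts [hxp rfl, hxq.1 rfl, not_adj_r hxq, not_adj_s hxq]

theorem encard_adjacency_inter (hJ : IsJordanCurve J) (hp : p ∈ J) :
    (adjacency p ∩ J).encard = 2 := by
  obtain ⟨q, hq, r, hr, hqr⟩ := hJ.nontrivial_adjacency_inter hp
  refine Set.encard_eq_two.2 ⟨q, r, hqr, Set.Subset.antisymm (fun s hs => ?_)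
    (Set.pair_subset_iff.2 ⟨hq, hr⟩)⟩
  have := hJ.eq_or_eq_or_eq_of_mem_adjacency hp hs hq hr
  exact this.imp_right fun h => h.resolve_right hqr

end IsJordanCurve

end Arc

section Plane

variable {J C : Set DigitalPlane} {p q y : DigitalPlane} {a b c d : ℤ}

/-- The point `(a, b)` of the digital plane, with integer coordinates. -/
def pt (a b : ℤ) : DigitalPlane := (ofInt a, ofInt b)

theorem pt_inj : pt a b = pt c d ↔ a = c ∧ b = d := by
  rw [pt, pt, Prod.mk.injEq, ofInt.apply_eq_iff_eq, ofInt.apply_eq_iff_eq]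

theorem exists_eq_pt (p : DigitalPlane) : ∃ a b, p = pt a b :=
  ⟨toInt p.1, toInt p.2, rfl⟩

theorem isPure_pt : IsPure (pt a b) ↔ Even (a + b) := by
  rw [Int.even_add']
  change (Even a ∧ Even b) ∨ (Odd a ∧ Odd b) ↔ _
  grind

theorem pt_notMem_of_odd (hpure : ∀ p ∈ J, IsPure p) (hab : Odd (a + b)) : pt a b ∉ J :=
  fun h => Int.not_even_iff_odd.2 hab (isPure_pt.1 (hpure _ h))

theorem pt_mem_adjacency_pt : pt c d ∈ adjacency (pt a b) ↔
    (c = a ∧ (d = b - 1 ∨ d = b + 1)) ∨ (d = b ∧ (c = a - 1 ∨ c = a + 1)) ∨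
      (Even (a + b) ∧ (c = a - 1 ∨ c = a + 1) ∧ (d = b - 1 ∨ d = b + 1)) := by
  rw [mem_adjacency_iff_specializes, Ne, pt_inj, pt, pt, specializes_prod, specializes_prod]
  simp only [ofInt_specializes_iff, Int.even_iff]
  omega

theorem exists_eq_pt_of_mem_adjacency (hp : IsPure p) (hq : IsPure q) (hpq : q ∈ adjacency p) :
    ∃ a b s t : ℤ, Even (a + b) ∧ (s = 1 ∨ s = -1) ∧ (t = 1 ∨ t = -1) ∧
      p = pt a b ∧ q = pt (a + s) (b + t) := by
  obtain ⟨a, b, rfl⟩ := exists_eq_pt p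
  obtain ⟨c, d, rfl⟩ := exists_eq_pt q
  rw [isPure_pt] at hp hq
  rw [pt_mem_adjacency_pt] at hpq
  refine ⟨a, b, c - a, d - b, hp, ?_, ?_, rfl, pt_inj.2 ⟨by omega, by omega⟩⟩ <;>
    rw [Int.even_iff] at hp hq <;> omega

theorem fst_snd_mem_adjacency (hp : IsPure p) (hq : IsPure q) (hpq : q ∈ adjacency p) :
    (p.1, q.2) ∈ adjacency p ∧ (p.1, q.2) ∈ adjacency q := by
  obtain ⟨a, b, s, t, -, hs, ht, rfl, rfl⟩ := exists_eq_pt_of_mem_adjacency hp hq hpq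
  change pt a (b + t) ∈ _ ∧ pt a (b + t) ∈ _
  rw [pt_mem_adjacency_pt, pt_mem_adjacency_pt]
  omega

theorem fst_snd_notMem (hpure : ∀ p ∈ J, IsPure p) (hp : IsPure p) (hq : IsPure q)
    (hpq : q ∈ adjacency p) : (p.1, q.2) ∉ J := by
  obtain ⟨a, b, s, t, hab, -, ht, rfl, rfl⟩ := exists_eq_pt_of_mem_adjacency hp hq hpq
  exact pt_notMem_of_odd hpure (by grind)

theorem adjacency_inter_eq_pair (hdeg : (adjacency p ∩ J).encard = 2) (hq : q ∈ J)
    (hpq : q ∈ adjacency p) : ∃ r, adjacency p ∩ J = {q, r} := by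
  obtain ⟨u, v, -, huv⟩ := Set.encard_eq_two.1 hdeg
  obtain rfl | rfl : q ∈ ({u, v} : Set DigitalPlane) := huv ▸ ⟨hpq, hq⟩
  exacts [⟨v, huv⟩, ⟨u, huv.trans (Set.pair_comm u q)⟩]

theorem connectedComponentIn_corner (hpure : ∀ p ∈ J, IsPure p) (hab : Even (a + b)) {u v : ℤ}
    (hu : u = 1 ∨ u = -1) (hv : v = 1 ∨ v = -1) (huv : pt (a + u) (b + v) ∉ J) :
    connectedComponentIn Jᶜ (pt (a + u) (b + v)) = connectedComponentIn Jᶜ (pt (a + u) b) ∧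
      connectedComponentIn Jᶜ (pt (a + u) (b + v)) = connectedComponentIn Jᶜ (pt a (b + v)) := by
  constructor <;>
    exact connectedComponentIn_eq_of_mem_adjacency huv (pt_notMem_of_odd hpure (by grind))
      (pt_mem_adjacency_pt.2 (by omega))

theorem corner_notMem_or_corner_notMem (hab : Even (a + b))
    (hdeg : (adjacency (pt a b) ∩ J).encard = 2) {s t u v u' v' : ℤ} (hs : s = 1 ∨ s = -1)
    (ht : t = 1 ∨ t = -1) (hu : u = 1 ∨ u = -1) (hv : v = 1 ∨ v = -1) (hu' : u' = 1 ∨ u' = -1)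
    (hv' : v' = 1 ∨ v' = -1) (hst : pt (a + s) (b + t) ∈ J) (hne : ¬(u = s ∧ v = t))
    (hne' : ¬(u' = s ∧ v' = t)) (huv : ¬(u = u' ∧ v = v')) :
    pt (a + u) (b + v) ∉ J ∨ pt (a + u') (b + v') ∉ J := by
  by_contra! hmem
  have adj : ∀ m n : ℤ, (m = 1 ∨ m = -1) → (n = 1 ∨ n = -1) →
      pt (a + m) (b + n) ∈ adjacency (pt a b) := fun m n hm hn =>
    pt_mem_adjacency_pt.2 (.inr (.inr ⟨hab, by omega, by omega⟩))
  obtain ⟨r, hr⟩ := adjacency_inter_eq_pair hdeg hst (adj s t hs ht)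
  have h : pt (a + u) (b + v) ∈ ({pt (a + s) (b + t), r} : Set DigitalPlane) :=
    hr ▸ ⟨adj u v hu hv, hmem.1⟩
  have h' : pt (a + u') (b + v') ∈ ({pt (a + s) (b + t), r} : Set DigitalPlane) :=
    hr ▸ ⟨adj u' v' hu' hv', hmem.2⟩
  simp only [Set.mem_insert_iff, Set.mem_singleton_iff, pt_inj, add_right_inj, hne, hne',
    false_or] at h h'
  exact huv (by simpa only [pt_inj, add_right_inj] using h.trans h'.symm)

/-- The eight neighbours of `p` form a cycle of alternately pure and mixed points. At most one of
its pure points other than `q` lies on `J`, so removing `J` leaves at most two pieces, and each of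
them contains one of the two mixed points next to `q`. -/
theorem connectedComponentIn_eq_or_eq (hpure : ∀ p ∈ J, IsPure p) (hp : p ∈ J)
    (hdeg : (adjacency p ∩ J).encard = 2) (hq : q ∈ J) (hpq : q ∈ adjacency p)
    (hpy : y ∈ adjacency p) (hy : y ∉ J) :
    connectedComponentIn Jᶜ y = connectedComponentIn Jᶜ (p.1, q.2) ∨
      connectedComponentIn Jᶜ y = connectedComponentIn Jᶜ (q.1, p.2) := by
  obtain ⟨a, b, s, t, hab, hs, ht, rfl, rfl⟩ :=
    exists_eq_pt_of_mem_adjacency (hpure p hp) (hpure q hq) hpq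
  obtain ⟨c, d, rfl⟩ := exists_eq_pt y
  change connectedComponentIn Jᶜ (pt c d) = connectedComponentIn Jᶜ (pt a (b + t)) ∨
    connectedComponentIn Jᶜ (pt c d) = connectedComponentIn Jᶜ (pt (a + s) b)
  have hs' : -s = 1 ∨ -s = -1 := by omega
  have ht' : -t = 1 ∨ -t = -1 := by omega
  have corner₁ := connectedComponentIn_corner hpure hab hs ht'
  have corner₂ := connectedComponentIn_corner hpure hab hs' ht
  have corner₃ := connectedComponentIn_corner hpure hab hs' ht'
  have notMem_or₁₂ : pt (a + s) (b + -t) ∉ J ∨ pt (a + -s) (b + t) ∉ J :=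
    corner_notMem_or_corner_notMem hab hdeg hs ht hs ht' hs' ht hq
      (by omega) (by omega) (by omega)
  have notMem_or₁₃ : pt (a + s) (b + -t) ∉ J ∨ pt (a + -s) (b + -t) ∉ J :=
    corner_notMem_or_corner_notMem hab hdeg hs ht hs ht' hs' ht' hq
      (by omega) (by omega) (by omega)
  have notMem_or₂₃ : pt (a + -s) (b + t) ∉ J ∨ pt (a + -s) (b + -t) ∉ J :=
    corner_notMem_or_corner_notMem hab hdeg hs ht hs' ht hs' ht' hq
      (by omega) (by omega) (by omega)
  rw [pt_mem_adjacency_pt] at hpy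
  have hc : c = a ∨ c = a + s ∨ c = a + -s := by omega
  have hd : d = b ∨ d = b + t ∨ d = b + -t := by omega
  have hne : ¬(c = a ∧ d = b) := by omega
  generalize connectedComponentIn Jᶜ = K at *
  have opposite_fst : K (pt (a + -s) b) = K (pt a (b + t)) ∨
      K (pt (a + -s) b) = K (pt (a + s) b) := by
    grind
  have opposite_snd : K (pt a (b + -t)) = K (pt a (b + t)) ∨
      K (pt a (b + -t)) = K (pt (a + s) b) := by
    grind
  rcases hc with rfl | rfl | rfl <;> rcases hd with rfl | rfl | rfl <;> grind

theorem adjacentToSet_iff_eq_or_eq (hpure : ∀ p ∈ J, IsPure p) (hp : p ∈ J)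
    (hdeg : (adjacency p ∩ J).encard = 2) (hq : q ∈ J) (hpq : q ∈ adjacency p)
    (hC : C ∈ components Jᶜ) :
    AdjacentToSet p C ↔
      C = connectedComponentIn Jᶜ (p.1, q.2) ∨ C = connectedComponentIn Jᶜ (q.1, p.2) := by
  constructor
  · rintro ⟨y, hyC, hpy⟩
    rw [eq_connectedComponentIn_of_mem_components hC hyC]
    exact connectedComponentIn_eq_or_eq hpure hp hdeg hq hpq hpy (subset_of_mem_components hC hyC)
  · have hqp : p ∈ adjacency q := mem_adjacency_comm.1 hpq
    rintro (rfl | rfl)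
    · exact ⟨_, mem_connectedComponentIn (fst_snd_notMem hpure (hpure p hp) (hpure q hq) hpq),
        (fst_snd_mem_adjacency (hpure p hp) (hpure q hq) hpq).1⟩
    · exact ⟨_, mem_connectedComponentIn (fst_snd_notMem hpure (hpure q hq) (hpure p hp) hqp),
        (fst_snd_mem_adjacency (hpure q hq) (hpure p hp) hqp).2⟩

end Plane

section Lattice

variable {J : Set DigitalPlane} {p q : DigitalPlane} {i j k l : ℤ}

/-- The pure point with coordinates `(i, j)` in the lattice of pure points, which is `ℤ²` rotated
by 45 degrees. -/
def vertex (i j : ℤ) : DigitalPlane := pt (i + j) (i - j)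

/-- The mixed point at the centre of the unit square of the lattice of pure points with corners
`vertex i j`, `vertex (i + 1) j`, `vertex i (j + 1)` and `vertex (i + 1) (j + 1)`. -/
def face (i j : ℤ) : DigitalPlane := pt (i + j + 1) (i - j)

theorem exists_eq_vertex_or_eq_face (p : DigitalPlane) :
    (∃ i j, p = vertex i j) ∨ ∃ i j, p = face i j := by
  obtain ⟨a, b, rfl⟩ := exists_eq_pt p
  obtain ⟨i, hi | hi⟩ := Int.even_or_odd' (a + b)
  · exact .inl ⟨i, a - i, pt_inj.2 (by omega)⟩
  · exact .inr ⟨i, a - 1 - i, pt_inj.2 (by omega)⟩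

theorem not_isPure_face : ¬IsPure (face i j) := by
  rw [face, isPure_pt, Int.not_even_iff_odd]
  exact ⟨i, by ring⟩

theorem exists_eq_vertex (hp : IsPure p) : ∃ i j, p = vertex i j := by
  refine (exists_eq_vertex_or_eq_face p).resolve_right ?_
  rintro ⟨i, j, rfl⟩
  exact not_isPure_face hp

theorem vertex_inj : vertex i j = vertex k l ↔ i = k ∧ j = l := by
  rw [vertex, vertex, pt_inj]
  omega

theorem vertex_mem_adjacency_vertex : vertex k l ∈ adjacency (vertex i j) ↔
    (l = j ∧ (k = i - 1 ∨ k = i + 1)) ∨ (k = i ∧ (l = j - 1 ∨ l = j + 1)) := by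
  rw [vertex, vertex, pt_mem_adjacency_pt, Int.even_iff]
  omega

theorem face_mem_adjacency_vertex :
    face k l ∈ adjacency (vertex i j) ↔ (k = i - 1 ∨ k = i) ∧ (l = j - 1 ∨ l = j) := by
  rw [vertex, face, pt_mem_adjacency_pt, Int.even_iff]
  omega

theorem face_notMem_adjacency_face : face k l ∉ adjacency (face i j) := by
  rw [face, face, pt_mem_adjacency_pt, Int.even_iff]
  omega

theorem sum_indicator_neighbors_eq_zero (hpure : ∀ p ∈ J, IsPure p)
    (hdeg : (adjacency (vertex i j) ∩ J).encard = 2) :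
    J.indicator (1 : DigitalPlane → ZMod 2) (vertex (i - 1) j) + J.indicator 1 (vertex (i + 1) j) +
      J.indicator 1 (vertex i (j - 1)) + J.indicator 1 (vertex i (j + 1)) = 0 := by
  classical
  let N : Finset DigitalPlane :=
    {vertex (i - 1) j, vertex (i + 1) j, vertex i (j - 1), vertex i (j + 1)}
  have hNJ : adjacency (vertex i j) ∩ J = ↑(N.filter (· ∈ J)) := by
    ext p
    rw [Finset.coe_filter]
    refine and_congr_left fun hp => ?_
    obtain ⟨k, l, rfl⟩ := exists_eq_vertex (hpure p hp)
    simp only [N, Finset.mem_insert, Finset.mem_singleton, vertex_inj, vertex_mem_adjacency_vertex]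
    tauto
  rw [hNJ, Set.encard_coe_eq_coe_finsetCard] at hdeg
  calc _ = ∑ p ∈ N, J.indicator (1 : DigitalPlane → ZMod 2) p := by
        rw [Finset.sum_insert, Finset.sum_insert, Finset.sum_insert, Finset.sum_singleton] <;>
          simp only [Finset.mem_insert, Finset.mem_singleton, vertex_inj, add_assoc] <;> omega
    _ = ((N.filter (· ∈ J)).card : ZMod 2) := by
        simp only [Set.indicator_apply, Pi.one_apply, Finset.sum_boole]
    _ = (2 : ℕ) := congrArg _ (by exact_mod_cast hdeg)
    _ = 0 := CharTwo.two_eq_zero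

/-- A labelling `f` of the faces changes across `J` if two faces sharing a side have different
labels precisely when both ends of that side lie on `J`. -/
def ChangesAcross (J : Set DigitalPlane) {α : Type*} (f : ℤ → ℤ → α) : Prop :=
  ∀ i j, (f (i + 1) j ≠ f i j ↔ vertex (i + 1) j ∈ J ∧ vertex (i + 1) (j + 1) ∈ J) ∧
    (f i (j + 1) ≠ f i j ↔ vertex i (j + 1) ∈ J ∧ vertex (i + 1) (j + 1) ∈ J)

theorem exists_changesAcross (hpure : ∀ p ∈ J, IsPure p)
    (hdeg : ∀ p ∈ J, (adjacency p ∩ J).encard = 2) :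
    ∃ f : ℤ → ℤ → ZMod 2, ChangesAcross J f := by
  let χ : ℤ → ℤ → ZMod 2 := fun i j => J.indicator 1 (vertex i j)
  have χ_mul_ne_zero : ∀ i j k l, χ i j * χ k l ≠ 0 ↔ vertex i j ∈ J ∧ vertex k l ∈ J := by
    intro i j k l
    rw [mul_ne_zero_iff, Set.indicator_apply_ne_zero, Set.indicator_apply_ne_zero]
    simp
  obtain ⟨f, hf⟩ := exists_potential (G := ZMod 2)
    (e₁ := fun i j => χ (i + 1) j * χ (i + 1) (j + 1))
    (e₂ := fun i j => χ i (j + 1) * χ (i + 1) (j + 1)) fun i j => by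
      by_cases hv : vertex (i + 1) (j + 1) ∈ J
      · have hsum : χ (i + 1 - 1) (j + 1) + χ (i + 1 + 1) (j + 1) +
            χ (i + 1) (j + 1 - 1) + χ (i + 1) (j + 1 + 1) = 0 :=
          sum_indicator_neighbors_eq_zero hpure (hdeg _ hv)
        have hχ : χ (i + 1) (j + 1) = 1 := Set.indicator_of_mem hv 1
        rw [add_sub_cancel_right, add_sub_cancel_right] at hsum
        simp only [hχ, mul_one, one_mul]
        linear_combination hsum - (χ i (j + 1) + χ (i + 1) (j + 1 + 1)) *
          (CharTwo.two_eq_zero : (2 : ZMod 2) = 0)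
      · have hχ : χ (i + 1) (j + 1) = 0 := Set.indicator_of_notMem hv 1
        simp only [hχ, mul_zero, zero_mul]
  refine ⟨f, fun i j => ⟨?_, ?_⟩⟩
  · rw [(hf i j).1, Ne, add_eq_left, ← Ne, χ_mul_ne_zero]
  · rw [(hf i j).2, Ne, add_eq_left, ← Ne, χ_mul_ne_zero]

/-- The colouring of the digital plane that gives `face i j` and `vertex i j` the colour `f i j`.
The points `vertex i j` and `face i j` are those whose sum and difference of coordinates, halved and
rounded down, are `i` and `j`. -/
def coloring {α : Type*} (f : ℤ → ℤ → α) (p : DigitalPlane) : α :=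
  f ((toInt p.1 + toInt p.2) / 2) ((toInt p.1 - toInt p.2) / 2)

theorem coloring_vertex {α : Type*} (f : ℤ → ℤ → α) (i j : ℤ) :
    coloring f (vertex i j) = f i j := by
  change f ((i + j + (i - j)) / 2) ((i + j - (i - j)) / 2) = f i j
  congr 1 <;> omega

theorem coloring_face {α : Type*} (f : ℤ → ℤ → α) (i j : ℤ) : coloring f (face i j) = f i j := by
  change f ((i + j + 1 + (i - j)) / 2) ((i + j + 1 - (i - j)) / 2) = f i j
  congr 1 <;> omega

theorem ChangesAcross.coloring_eq_of_vertex {α : Type*} {f : ℤ → ℤ → α} (hf : ChangesAcross J f)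
    (hx : vertex i j ∉ J) (hp : p ∉ J) (h : p ∈ adjacency (vertex i j)) :
    coloring f (vertex i j) = coloring f p := by
  have eq_left : f i j = f (i - 1) j := by
    have h := (hf (i - 1) j).1
    rw [sub_add_cancel] at h
    exact not_ne_iff.1 fun hne => hx (h.1 hne).1
  have eq_below : f i j = f i (j - 1) := by
    have h := (hf i (j - 1)).2
    rw [sub_add_cancel] at h
    exact not_ne_iff.1 fun hne => hx (h.1 hne).1
  have eq_diag : f (i - 1) j = f (i - 1) (j - 1) := by
    have h := (hf (i - 1) (j - 1)).2
    rw [sub_add_cancel, sub_add_cancel] at h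
    exact not_ne_iff.1 fun hne => hx (h.1 hne).2
  obtain ⟨k, l, rfl⟩ | ⟨k, l, rfl⟩ := exists_eq_vertex_or_eq_face p
  · rw [vertex_mem_adjacency_vertex] at h
    rw [coloring_vertex, coloring_vertex]
    grind [hf i j]
  · rw [face_mem_adjacency_vertex] at h
    rw [coloring_vertex, coloring_face]
    grind

theorem ChangesAcross.coloring_eq {α : Type*} {f : ℤ → ℤ → α} (hf : ChangesAcross J f)
    (hp : p ∉ J) (hq : q ∉ J) (hpq : q ∈ adjacency p) : coloring f p = coloring f q := by
  obtain ⟨i, j, rfl⟩ | ⟨i, j, rfl⟩ := exists_eq_vertex_or_eq_face p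
  · exact hf.coloring_eq_of_vertex hp hq hpq
  · obtain ⟨k, l, rfl⟩ | ⟨k, l, rfl⟩ := exists_eq_vertex_or_eq_face q
    · exact (hf.coloring_eq_of_vertex hq hp (mem_adjacency_comm.1 hpq)).symm
    · exact absurd hpq face_notMem_adjacency_face

theorem ChangesAcross.coloring_ne {α : Type*} {f : ℤ → ℤ → α} (hf : ChangesAcross J f)
    (hpure : ∀ p ∈ J, IsPure p) (hp : p ∈ J) (hq : q ∈ J) (hpq : q ∈ adjacency p) :
    coloring f (p.1, q.2) ≠ coloring f (q.1, p.2) := by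
  have ne_right : ∀ i j, vertex i j ∈ J → vertex (i + 1) j ∈ J →
      coloring f (pt (i + j) (i + 1 - j)) ≠ coloring f (pt (i + 1 + j) (i - j)) := by
    intro i j h h'
    have hface : pt (i + j) (i + 1 - j) = face i (j - 1) := pt_inj.2 (by omega)
    have hface' : pt (i + 1 + j) (i - j) = face i j := pt_inj.2 (by omega)
    have hne := (hf i (j - 1)).2
    rw [sub_add_cancel] at hne
    rw [hface, hface', coloring_face, coloring_face]
    exact (hne.2 ⟨h, h'⟩).symm
  have ne_above : ∀ i j, vertex i j ∈ J → vertex i (j + 1) ∈ J →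
      coloring f (pt (i + j) (i - (j + 1))) ≠ coloring f (pt (i + (j + 1)) (i - j)) := by
    intro i j h h'
    have hface : pt (i + j) (i - (j + 1)) = face (i - 1) j := pt_inj.2 (by omega)
    have hface' : pt (i + (j + 1)) (i - j) = face i j := pt_inj.2 (by omega)
    have hne := (hf (i - 1) j).1
    rw [sub_add_cancel] at hne
    rw [hface, hface', coloring_face, coloring_face]
    exact (hne.2 ⟨h, h'⟩).symm
  obtain ⟨i, j, rfl⟩ := exists_eq_vertex (hpure p hp)
  obtain ⟨k, l, rfl⟩ := exists_eq_vertex (hpure q hq)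
  rw [vertex_mem_adjacency_vertex] at hpq
  obtain ⟨rfl, hk⟩ | ⟨rfl, hl⟩ := hpq
  · obtain rfl | rfl : i = k + 1 ∨ k = i + 1 := by omega
    exacts [(ne_right k l hq hp).symm, ne_right i l hp hq]
  · obtain rfl | rfl : j = l + 1 ∨ l = j + 1 := by omega
    exacts [(ne_above k l hq hp).symm, ne_above k j hp hq]

end Lattice

section Separation

variable {J C : Set DigitalPlane} {p q : DigitalPlane}

theorem connectedComponentIn_ne (hpure : ∀ p ∈ J, IsPure p)
    (hdeg : ∀ p ∈ J, (adjacency p ∩ J).encard = 2) (hp : p ∈ J) (hq : q ∈ J)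
    (hpq : q ∈ adjacency p) :
    connectedComponentIn Jᶜ (p.1, q.2) ≠ connectedComponentIn Jᶜ (q.1, p.2) := by
  intro heq
  obtain ⟨f, hf⟩ := exists_changesAcross hpure hdeg
  have hpq_mem : (p.1, q.2) ∈ connectedComponentIn Jᶜ (p.1, q.2) :=
    mem_connectedComponentIn (fst_snd_notMem hpure (hpure p hp) (hpure q hq) hpq)
  have hqp_mem : (q.1, p.2) ∈ connectedComponentIn Jᶜ (p.1, q.2) :=
    heq ▸ mem_connectedComponentIn
      (fst_snd_notMem hpure (hpure q hq) (hpure p hp) (mem_adjacency_comm.1 hpq))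
  have hsub := connectedComponentIn_subset Jᶜ (p.1, q.2)
  exact hf.coloring_ne hpure hp hq hpq <|
    eq_of_isPreconnected_of_mem_adjacency isPreconnected_connectedComponentIn
      (fun x hx y hy hxy => hf.coloring_eq (hsub hx) (hsub hy) hxy) hpq_mem hqp_mem

theorem components_compl_eq_pair (hpure : ∀ p ∈ J, IsPure p)
    (hadj : ∀ C ∈ components Jᶜ, AdjacentToSet p C) (hp : p ∈ J)
    (hdeg : (adjacency p ∩ J).encard = 2) (hq : q ∈ J) (hpq : q ∈ adjacency p) :
    components Jᶜ = {connectedComponentIn Jᶜ (p.1, q.2), connectedComponentIn Jᶜ (q.1, p.2)} := by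
  refine Set.Subset.antisymm (fun C hC => ?_) (Set.pair_subset_iff.2 ⟨?_, ?_⟩)
  · exact (adjacentToSet_iff_eq_or_eq hpure hp hdeg hq hpq hC).1 (hadj C hC)
  · exact ⟨_, fst_snd_notMem hpure (hpure p hp) (hpure q hq) hpq, rfl⟩
  · exact ⟨_, fst_snd_notMem hpure (hpure q hq) (hpure p hp) (mem_adjacency_comm.1 hpq), rfl⟩

theorem adjacentToSet_of_mem_components (hJ : IsConnected J) (hpure : ∀ p ∈ J, IsPure p)
    (hdeg : ∀ p ∈ J, (adjacency p ∩ J).encard = 2) (hp : p ∈ J) (hC : C ∈ components Jᶜ) :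
    AdjacentToSet p C := by
  have adj_iff : ∀ x ∈ J, ∀ y ∈ J, y ∈ adjacency x →
      AdjacentToSet x C = AdjacentToSet y C := by
    intro x hx y hy hxy
    rw [adjacentToSet_iff_eq_or_eq hpure hx (hdeg x hx) hy hxy hC,
      adjacentToSet_iff_eq_or_eq hpure hy (hdeg y hy) hx (mem_adjacency_comm.1 hxy) hC, or_comm]
  obtain ⟨x, hx, hxC⟩ := exists_mem_adjacentToSet hJ.nonempty hC
  exact (eq_of_isPreconnected_of_mem_adjacency (f := (AdjacentToSet · C)) hJ.isPreconnected
    adj_iff hx hp).mp hxC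

end Separation

end DigitalTopology

open DigitalTopology in
theorem mainTheorem5_general {J : Set DigitalPlane} (hJ : IsConnected J)
    (hpure : ∀ p ∈ J, IsPure p) (hdeg : ∀ p ∈ J, (adjacency p ∩ J).encard = 2) :
    (components Jᶜ).encard = 2 ∧ ∀ p ∈ J, ∀ C ∈ components Jᶜ, AdjacentToSet p C := by
  have hadj : ∀ p ∈ J, ∀ C ∈ components Jᶜ, AdjacentToSet p C := fun _ hp _ hC =>
    adjacentToSet_of_mem_components hJ hpure hdeg hp hC
  refine ⟨?_, hadj⟩
  obtain ⟨p, hp⟩ := hJ.nonempty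
  obtain ⟨q, hpq, hq⟩ : (adjacency p ∩ J).Nonempty :=
    Set.nonempty_of_encard_ne_zero (by rw [hdeg p hp]; exact two_ne_zero)
  rw [components_compl_eq_pair hpure (hadj p hp) hp (hdeg p hp) hq hpq]
  exact Set.encard_pair (connectedComponentIn_ne hpure hdeg hp hq hpq)

theorem mainTheorem5 (J : Set DigitalPlane) (hJ : DigitalTopology.IsJordanCurve J)
    (hpure : ∀ p ∈ J, DigitalTopology.IsPure p) (hcard : 4 < J.encard) :
    (DigitalTopology.components Jᶜ).encard = 2 ∧
      ∀ p ∈ J, ∀ C ∈ DigitalTopology.components Jᶜ, DigitalTopology.AdjacentToSet p C :=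
  mainTheorem5_general hJ.isConnected hpure fun _ hp => hJ.encard_adjacency_inter hp
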